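/- Let $K^2$ be the following two-player impartial game. Positions are pairs $(x,y)\in\mathbb{N}^2$ (with $0\in\mathbb N$). The terminal positions are those with $x+y\le 2$; no move is possible from them. From a non-terminal position $(x,y)$ the player to move chooses $n>0$ and moves to $(x-n,y)$ (if $n\le x$), to $(x,y-n)$ (if $n\le y$), or to $(x-n,y-n)$ (if $n\le\min\{x,y\}$). A player who moves into a terminal position wins. A position is a $\mathcal P$-position if none of its options is a $\mathcal P$-position; in particular every terminal position is a $\mathcal P$-position. Let $\phi=(1+\sqrt5)/2$ and define $g:\mathbb{N}\to\{0,1\}$ by $g(0)=1$, $g(1)=0$ and, for $n\ge 2$, \[ g(n)=\begin{cases}1-g(m), & \text{if } \lfloor n\phi\rfloor=\lfloor m(\phi+1)\rfloor+1 \text{ for some } m\ge 0,\\ 1, & \text{otherwise}\end{cases} \] (such an $m$ is unique and smaller than $n$). Theorem. The set of $\mathcal P$-positions of $K^2$ is exactly \[ \{(0,0),(1,1)\}\cup\{(\lfloor n\phi\rfloor+g(n)-1,\ \lfloor n\phi^2\rfloor+g(n))\mid n\ge 0\}\cup\{(\lfloor n\phi^2\rfloor+g(n),\ \lfloor n\phi\rfloor+g(n)-1)\mid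 n\ge 0\}. \] -/

import Mathlib

/-- A Wythoff (queen) move on `ℕ²`: remove a positive number of tokens from one of the two piles,
or the same positive number from both. -/
inductive WythoffMove : ℕ × ℕ → ℕ × ℕ → Prop
  | horizontal (x y n : ℕ) (hn : 0 < n) (hx : n ≤ x) : WythoffMove (x, y) (x - n, y)
  | vertical (x y n : ℕ) (hn : 0 < n) (hy : n ≤ y) : WythoffMove (x, y) (x, y - n)
  | diagonal (x y n : ℕ) (hn : 0 < n) (hxy : n ≤ min x y) : WythoffMove (x, y) (x - n, y - n)

/-- The terminal positions of the game `K²`: the game is over as soon as one of them is reached,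
and the player who moved there wins. -/
def k2Terminal : Set (ℕ × ℕ) := {p | p.1 + p.2 ≤ 2}

/-- A legal move of the game `K²`: a Wythoff move from a position that is not terminal. -/
def K2Move (p q : ℕ × ℕ) : Prop := p ∉ k2Terminal ∧ WythoffMove p q

theorem K2Move.sum_lt {p q : ℕ × ℕ} (h : K2Move p q) : q.1 + q.2 < p.1 + p.2 := by
  obtain ⟨-, h⟩ := h
  cases h <;> simp only <;> omega

/-- `p` is a `P`-position of `K²` (the player about to move loses): no option of `p` is a
`P`-position, that is, every option is an `N`-position. Terminal positions have no options, so they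
are `P`-positions. -/
def IsK2PPosition (p : ℕ × ℕ) : Prop :=
  ∀ q : ℕ × ℕ, K2Move p q → ¬ IsK2PPosition q
termination_by p.1 + p.2
decreasing_by rename_i h; exact h.sum_lt

theorem lt_of_floor_eq {n m : ℕ}
    (h : ⌊(n : ℝ) * Real.goldenRatio⌋ = ⌊(m : ℝ) * (Real.goldenRatio + 1)⌋ + 1) : m < n := by
  have h2 : (2 * m : ℤ) ≤ ⌊(m : ℝ) * (Real.goldenRatio + 1)⌋ := by
    rw [Int.le_floor]
    push_cast
    nlinarith [Real.one_lt_goldenRatio, (Nat.cast_nonneg m : (0 : ℝ) ≤ m)]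
  have h3 : ((2 * m + 1 : ℤ) : ℝ) ≤ (n : ℝ) * Real.goldenRatio := by
    rw [← Int.le_floor]
    omega
  push_cast at h3
  have h4 : (n : ℝ) * Real.goldenRatio ≤ n * 2 :=
    mul_le_mul_of_nonneg_left Real.goldenRatio_lt_two.le (Nat.cast_nonneg n)
  have h5 : (m : ℝ) < n := by linarith
  exact_mod_cast h5

open Classical in
/-- The sequence `g`: `g 0 = 1`, `g 1 = 0`, and for `n ≥ 2`, `g n = 1 - g m` if
`⌊nφ⌋ = ⌊m(φ+1)⌋ + 1` for some `m` (which is then unique and less than `n`), and `g n = 1` if there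
is no such `m`. All values are `0` or `1`, so the subtraction does not truncate. -/
noncomputable def gSeq (n : ℕ) : ℕ :=
  if n = 0 then 1
  else if n = 1 then 0
  else if h : ∃ m : ℕ,
      ⌊(n : ℝ) * Real.goldenRatio⌋ = ⌊(m : ℝ) * (Real.goldenRatio + 1)⌋ + 1 then
    1 - gSeq h.choose
  else 1
termination_by n
decreasing_by exact lt_of_floor_eq h.choose_spec

theorem gSeq_le_one (n : ℕ) : gSeq n ≤ 1 := by
  rw [gSeq]
  split_ifs <;> omega

theorem floor_mul_goldenRatio_add_one_injective {m m' : ℕ}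
    (h : ⌊(m : ℝ) * (Real.goldenRatio + 1)⌋ = ⌊(m' : ℝ) * (Real.goldenRatio + 1)⌋) : m = m' := by
  have hlt : |(m : ℝ) * (Real.goldenRatio + 1) - (m' : ℝ) * (Real.goldenRatio + 1)| < 1 :=
    Int.abs_sub_lt_one_of_floor_eq_floor h
  rw [abs_lt] at hlt
  have h1 := Real.one_lt_goldenRatio
  rcases lt_trichotomy m m' with hm | hm | hm
  · have : (m : ℝ) + 1 ≤ m' := by exact_mod_cast hm
    nlinarith
  · exact hm
  · have : (m' : ℝ) + 1 ≤ m := by exact_mod_cast hm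
    nlinarith

theorem gSeq_zero : gSeq 0 = 1 := by rw [gSeq]; simp

theorem gSeq_one : gSeq 1 = 0 := by rw [gSeq]; simp

theorem gSeq_of_floor_eq {n m : ℕ} (hn : 2 ≤ n)
    (h : ⌊(n : ℝ) * Real.goldenRatio⌋ = ⌊(m : ℝ) * (Real.goldenRatio + 1)⌋ + 1) :
    gSeq n = 1 - gSeq m := by
  have hex : ∃ m : ℕ,
      ⌊(n : ℝ) * Real.goldenRatio⌋ = ⌊(m : ℝ) * (Real.goldenRatio + 1)⌋ + 1 := ⟨m, h⟩
  have huniq : hex.choose = m :=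
    floor_mul_goldenRatio_add_one_injective (by linarith [hex.choose_spec])
  rw [gSeq, if_neg (by omega), if_neg (by omega), dif_pos hex, huniq]

theorem gSeq_of_forall_floor_ne {n : ℕ} (hn : 2 ≤ n)
    (h : ∀ m : ℕ, ⌊(n : ℝ) * Real.goldenRatio⌋ ≠ ⌊(m : ℝ) * (Real.goldenRatio + 1)⌋ + 1) :
    gSeq n = 1 := by
  rw [gSeq, if_neg (by omega), if_neg (by omega), dif_neg (by simpa using h)]

/-!
The proof is a Wythoff argument for a perturbed Wythoff sequence. Write `A n = ⌊nφ⌋` and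
`B n = ⌊nφ²⌋ = A n + n`, and let `a n = A n + g n - 1`, `b n = B n + g n`, so that
`b n - a n = n + 1`.

By Rayleigh's theorem the values `A n` and `B n` with `n ≥ 1` partition the positive integers, and
since `A` is strictly increasing, consecutive values of `B` differ by at least `2`; hence `B m + 1`
is always some `A n`. By the recursion of `g`, for `n ≥ 2` one has `g n = 0` exactly if
`A n = B m + 1` with `g m = 1`. In that case `a n = B m` and `b m = A n`; if no such relation
involves a value, it stays where it was. Passing from `A`, `B` to `a`, `b` thus merely exchanges the
entries `B m` and `B m + 1` whenever `g m = 1`, and so `a n` and `b n` with `n ≥ 2` partition the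
integers `≥ 3` (`isK2PairSystem_lowerSeq_upperSeq`); the exchange also keeps `a` increasing.

For such a pair of sequences, the pairs `(a n, b n)`, up to order, together with `(0, 0)` and
`(1, 1)` form a kernel of the move graph of `K²`, and a kernel is the set of `P`-positions
(`isK2PPosition_iff_of_kernel`). A move inside the kernel would keep a coordinate or the difference,
each of which determines the pair. From a position `(x, y)` outside it with `3 ≤ x < y`, either
`x = b n` and a move to `(b n, a n)` exists, or `x = a n`: then `y > b n` allows a move to
`(a n, b n)`, and `y < b n` gives a difference less than `n + 1`, so that the pair with this
difference is smaller and lies on the diagonal of `(x, y)`.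
-/

/-! ### Moves and kernels of `K²` -/

/-- `p` is a terminal position `(0, 0)` or `(1, 1)`, or one of the pairs `(a n, b n)` up to order. -/
def InPairs (a b : ℕ → ℕ) (p : ℕ × ℕ) : Prop :=
  p = (0, 0) ∨ p = (1, 1) ∨ (∃ n, p = (a n, b n)) ∨ ∃ n, p = (b n, a n)

theorem wythoffMove_iff {x y x' y' : ℕ} : WythoffMove (x, y) (x', y') ↔
    (x' < x ∧ y' = y) ∨ (x' = x ∧ y' < y) ∨ (x' < x ∧ x' + y = x + y') := by
  constructor
  · intro h
    cases h <;> omega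
  · rintro (⟨h, rfl⟩ | ⟨rfl, h⟩ | ⟨h, h'⟩)
    · have := WythoffMove.horizontal x y' (x - x') (by omega) (by omega)
      rwa [show x - (x - x') = x' by omega] at this
    · have := WythoffMove.vertical x' y (y - y') (by omega) (by omega)
      rwa [show y - (y - y') = y' by omega] at this
    · have := WythoffMove.diagonal x y (x - x') (by omega) (by omega)
      rwa [show x - (x - x') = x' by omega, show y - (x - x') = y' by omega] at this

theorem k2Move_iff {x y x' y' : ℕ} : K2Move (x, y) (x', y') ↔ 2 < x + y ∧
    ((x' < x ∧ y' = y) ∨ (x' = x ∧ y' < y) ∨ (x' < x ∧ x' + y = x + y')) := by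
  simp [K2Move, k2Terminal, wythoffMove_iff]

theorem K2Move.swap {x y x' y' : ℕ} (h : K2Move (x, y) (x', y')) : K2Move (y, x) (y', x') := by
  rw [k2Move_iff] at h ⊢
  omega

theorem InPairs.swap {a b : ℕ → ℕ} {x y : ℕ} (h : InPairs a b (x, y)) : InPairs a b (y, x) := by
  simp only [InPairs, Prod.mk.injEq] at h ⊢
  rcases h with h | h | ⟨n, h⟩ | ⟨n, h⟩
  · exact Or.inl h.symm
  · exact Or.inr (Or.inl h.symm)
  · exact Or.inr (Or.inr (Or.inr ⟨n, h.symm⟩))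
  · exact Or.inr (Or.inr (Or.inl ⟨n, h.symm⟩))

/-- A set of positions is the set of `P`-positions as soon as it is a kernel of the move graph:
no move joins two of its members, and each position outside it has a move into it. -/
theorem isK2PPosition_iff_of_kernel {S : ℕ × ℕ → Prop}
    (indep : ∀ p q, S p → K2Move p q → ¬ S q)
    (absorb : ∀ p, ¬ S p → ∃ q, K2Move p q ∧ S q) (p : ℕ × ℕ) : IsK2PPosition p ↔ S p := by
  induction hs : p.1 + p.2 using Nat.strong_induction_on generalizing p with
  | _ s ih =>
    subst hs
    rw [IsK2PPosition]
    constructor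
    · intro h
      by_contra hp
      obtain ⟨q, hq, hSq⟩ := absorb p hp
      exact h q hq ((ih _ hq.sum_lt q rfl).2 hSq)
    · intro hp q hq hPq
      exact indep p q hp hq ((ih _ hq.sum_lt q rfl).1 hPq)

/-! ### Pair systems -/

/-- The combinatorial properties of the two sequences that make the pairs `(a n, b n)` play the role
of the Wythoff pairs for `K²`: the differences `b n - a n` are `1, 2, 3, …`, the pairs with
`n = 0, 1` are the terminal positions `(0, 1)` and `(0, 2)`, and from `n = 2` on the two sequences
partition the integers `≥ 3`. -/
structure IsK2PairSystem (a b : ℕ → ℕ) : Prop where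
  b_eq : ∀ n, b n = a n + n + 1
  a_zero : a 0 = 0
  a_one : a 1 = 0
  three_le : ∀ n, 2 ≤ n → 3 ≤ a n
  mono : ∀ m n, m < n → 2 ≤ n → a m < a n
  disjoint : ∀ m n, 2 ≤ m → 2 ≤ n → a m ≠ b n
  cover : ∀ v, 3 ≤ v → ∃ n, 2 ≤ n ∧ (v = a n ∨ v = b n)

namespace IsK2PairSystem

variable {a b : ℕ → ℕ}

theorem small_or_le (h : IsK2PairSystem a b) (n : ℕ) :
    (n = 0 ∧ a n = 0 ∧ b n = 1) ∨ (n = 1 ∧ a n = 0 ∧ b n = 2) ∨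
      (2 ≤ n ∧ 3 ≤ a n ∧ b n = a n + n + 1) := by
  have h0 := h.a_zero
  have h1 := h.a_one
  have hb := h.b_eq n
  rcases n with _ | _ | n
  · simp_all
  · simp_all
  · exact Or.inr (Or.inr ⟨by omega, h.three_le _ (by omega), hb⟩)

theorem a_inj (h : IsK2PairSystem a b) {m n : ℕ} (hn : 2 ≤ n) (e : a m = a n) : m = n := by
  have h3 := h.three_le n hn
  have hm := h.small_or_le m
  rcases lt_trichotomy m n with hl | hl | hl
  · have := h.mono m n hl hn; omega
  · exact hl
  · have := h.mono n m hl (by omega); omega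

theorem b_inj (h : IsK2PairSystem a b) {m n : ℕ} (hn : 2 ≤ n) (e : b m = b n) : m = n := by
  have hbm := h.b_eq m
  have hbn := h.b_eq n
  have h3 := h.three_le n hn
  have hm := h.small_or_le m
  rcases lt_trichotomy m n with hl | hl | hl
  · have := h.mono m n hl hn; omega
  · exact hl
  · have := h.mono n m hl (by omega); omega

theorem a_ne_b (h : IsK2PairSystem a b) (m n : ℕ) : a m ≠ b n := by
  have hm := h.small_or_le m
  have hn := h.small_or_le n
  by_cases h2 : 2 ≤ m ∧ 2 ≤ n
  · exact h.disjoint m n h2.1 h2.2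
  · omega

theorem not_inPairs_of_move (h : IsK2PairSystem a b) (n : ℕ) {x y : ℕ}
    (hmove : K2Move (a n, b n) (x, y)) : ¬ InPairs a b (x, y) := by
  rw [k2Move_iff] at hmove
  obtain ⟨hnt, hmove⟩ := hmove
  have hn := h.small_or_le n
  have hn2 : 2 ≤ n := by omega
  have hbn := h.b_eq n
  simp only [InPairs, Prod.mk.injEq]
  rintro (⟨rfl, rfl⟩ | ⟨rfl, rfl⟩ | ⟨m, rfl, rfl⟩ | ⟨m, rfl, rfl⟩)
  · omega
  · omega
  · have hbm := h.b_eq m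
    have : m = n := by
      rcases hmove with hm | hm | hm
      · exact h.b_inj hn2 hm.2
      · exact h.a_inj hn2 hm.1
      · omega
    subst this
    omega
  · have hbm := h.b_eq m
    rcases hmove with hm | hm | hm
    · exact h.a_ne_b _ _ hm.2
    · exact h.a_ne_b _ _ hm.1.symm
    · omega

theorem exists_move_of_le (h : IsK2PairSystem a b) {x y : ℕ} (hxy : x ≤ y)
    (hS : ¬ InPairs a b (x, y)) : ∃ q : ℕ × ℕ, K2Move (x, y) q ∧ InPairs a b q := by
  simp only [InPairs, Prod.mk.injEq, not_or, not_exists] at hS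
  obtain ⟨h00, h11, hab, hba⟩ := hS
  have a0 := h.a_zero
  have a1 := h.a_one
  have hb0 := h.b_eq 0
  have hb1 := h.b_eq 1
  have hab0 := hab 0
  have hab1 := hab 1
  rcases hxy.eq_or_lt with rfl | hlt
  · exact ⟨(0, 0), k2Move_iff.2 (by omega), Or.inl rfl⟩
  by_cases hx0 : x = 0
  · exact ⟨(0, 0), k2Move_iff.2 (by omega), Or.inl rfl⟩
  by_cases hx1 : x = 1
  · exact ⟨(1, 1), k2Move_iff.2 (by omega), Or.inr (Or.inl rfl)⟩
  by_cases hx2 : x = 2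
  · exact ⟨(b 1, a 1), k2Move_iff.2 (by omega), Or.inr (Or.inr (Or.inr ⟨1, rfl⟩))⟩
  obtain ⟨n, hn2, rfl | rfl⟩ := h.cover x (by omega)
  · have hbn := h.b_eq n
    have habn := hab n
    rcases lt_or_ge (b n) y with hy | hy
    · exact ⟨(a n, b n), k2Move_iff.2 (by omega), Or.inr (Or.inr (Or.inl ⟨n, rfl⟩))⟩
    · -- The diagonal through `(a n, y)` carries the pair of index `y - a n - 1 < n`.
      have hm := h.mono (y - a n - 1) n (by omega) hn2
      have hbm := h.b_eq (y - a n - 1)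
      exact ⟨(a (y - a n - 1), b (y - a n - 1)), k2Move_iff.2 (by omega),
        Or.inr (Or.inr (Or.inl ⟨_, rfl⟩))⟩
  · have hbn := h.b_eq n
    exact ⟨(b n, a n), k2Move_iff.2 (by omega), Or.inr (Or.inr (Or.inr ⟨n, rfl⟩))⟩

theorem isK2PPosition_iff (h : IsK2PairSystem a b) (p : ℕ × ℕ) :
    IsK2PPosition p ↔ InPairs a b p := by
  refine isK2PPosition_iff_of_kernel ?_ ?_ p
  · rintro p ⟨x, y⟩ (rfl | rfl | ⟨n, rfl⟩ | ⟨n, rfl⟩) hmove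
    · rw [k2Move_iff] at hmove; omega
    · rw [k2Move_iff] at hmove; omega
    · exact h.not_inPairs_of_move n hmove
    · exact fun hq => h.not_inPairs_of_move n hmove.swap hq.swap
  · rintro ⟨x, y⟩ hS
    rcases le_total x y with hxy | hxy
    · exact h.exists_move_of_le hxy hS
    · obtain ⟨⟨x', y'⟩, hmove, hq⟩ := h.exists_move_of_le hxy fun hS' => hS hS'.swap
      exact ⟨(y', x'), hmove.swap, hq.swap⟩

end IsK2PairSystem

/-! ### The Wythoff sequences -/

/-- The lower Wythoff sequence `⌊nφ⌋`, with natural number values. The upper Wythoff sequence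
`⌊nφ²⌋` is `n ↦ wythoffLower n + n`. -/
noncomputable def wythoffLower (n : ℕ) : ℕ := ⌊(n : ℝ) * Real.goldenRatio⌋₊

theorem floor_mul_goldenRatio (n : ℕ) :
    ⌊(n : ℝ) * Real.goldenRatio⌋ = (wythoffLower n : ℤ) :=
  (Int.natCast_floor_eq_floor (mul_nonneg n.cast_nonneg Real.goldenRatio_pos.le)).symm

theorem floor_mul_goldenRatio_add_one (n : ℕ) :
    ⌊(n : ℝ) * (Real.goldenRatio + 1)⌋ = (wythoffLower n : ℤ) + n := by
  rw [mul_add, mul_one, Int.floor_add_natCast, floor_mul_goldenRatio]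

theorem wythoffLower_strictMono : StrictMono wythoffLower := by
  refine strictMono_nat_of_lt_succ fun n => ?_
  have h : ⌊(n : ℝ) * Real.goldenRatio⌋ + 1 ≤ ⌊((n + 1 : ℕ) : ℝ) * Real.goldenRatio⌋ := by
    rw [Int.le_floor]
    push_cast
    linarith [Int.floor_le ((n : ℝ) * Real.goldenRatio), Real.one_lt_goldenRatio]
  rw [floor_mul_goldenRatio, floor_mul_goldenRatio] at h
  omega

theorem wythoffLower_zero : wythoffLower 0 = 0 := by simp [wythoffLower]

theorem wythoffLower_one : wythoffLower 1 = 1 := by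
  have h : ⌊((1 : ℕ) : ℝ) * Real.goldenRatio⌋ = 1 := by
    rw [Int.floor_eq_iff]
    push_cast
    constructor <;> linarith [Real.one_lt_goldenRatio, Real.goldenRatio_lt_two]
  rw [floor_mul_goldenRatio] at h
  omega

theorem wythoffLower_two : wythoffLower 2 = 3 := by
  have h : ⌊((2 : ℕ) : ℝ) * Real.goldenRatio⌋ = 3 := by
    rw [Int.floor_eq_iff]
    push_cast
    constructor <;>
      nlinarith [Real.one_lt_goldenRatio, Real.goldenRatio_lt_two, Real.goldenRatio_sq]
  rw [floor_mul_goldenRatio] at h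
  omega

theorem goldenRatio_holderConjugate :
    Real.goldenRatio.HolderConjugate (Real.goldenRatio + 1) := by
  rw [Real.holderConjugate_iff]
  refine ⟨Real.one_lt_goldenRatio, ?_⟩
  have hsq := Real.goldenRatio_sq
  have h0 := Real.goldenRatio_ne_zero
  rw [← hsq]
  generalize Real.goldenRatio = x at hsq h0
  field_simp
  exact hsq.symm

theorem mem_beattySeq_goldenRatio_iff (v : ℕ) :
    (v : ℤ) ∈ {beattySeq Real.goldenRatio k | k > 0} ↔ ∃ n, 1 ≤ n ∧ v = wythoffLower n := by
  constructor
  · rintro ⟨k, hk, e⟩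
    lift k to ℕ using hk.le
    refine ⟨k, by omega, ?_⟩
    rw [beattySeq, Int.cast_natCast, floor_mul_goldenRatio] at e
    omega
  · rintro ⟨n, hn, rfl⟩
    refine ⟨n, by omega, ?_⟩
    rw [beattySeq, Int.cast_natCast, floor_mul_goldenRatio]

theorem mem_beattySeq_goldenRatio_add_one_iff (v : ℕ) :
    (v : ℤ) ∈ {beattySeq (Real.goldenRatio + 1) k | k > 0} ↔
      ∃ n, 1 ≤ n ∧ v = wythoffLower n + n := by
  constructor
  · rintro ⟨k, hk, e⟩
    lift k to ℕ using hk.le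
    refine ⟨k, by omega, ?_⟩
    rw [beattySeq, Int.cast_natCast, floor_mul_goldenRatio_add_one] at e
    omega
  · rintro ⟨n, hn, rfl⟩
    refine ⟨n, by omega, ?_⟩
    rw [beattySeq, Int.cast_natCast, floor_mul_goldenRatio_add_one, Nat.cast_add]

theorem pos_iff_xor_wythoff (v : ℕ) :
    0 < v ↔ Xor (∃ n, 1 ≤ n ∧ v = wythoffLower n) (∃ n, 1 ≤ n ∧ v = wythoffLower n + n) := by
  have h := Set.ext_iff.1 (Real.goldenRatio_irrational.beattySeq_symmDiff_beattySeq_pos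
    goldenRatio_holderConjugate) (v : ℤ)
  rw [Set.mem_symmDiff, mem_beattySeq_goldenRatio_iff, mem_beattySeq_goldenRatio_add_one_iff] at h
  rw [Set.mem_ofPred_eq, Nat.cast_pos] at h
  exact h.symm

theorem exists_wythoff_eq {v : ℕ} (hv : 0 < v) :
    ∃ n, 1 ≤ n ∧ (v = wythoffLower n ∨ v = wythoffLower n + n) := by
  rcases (pos_iff_xor_wythoff v).1 hv with ⟨⟨n, hn, h⟩, -⟩ | ⟨⟨n, hn, h⟩, -⟩
  · exact ⟨n, hn, Or.inl h⟩
  · exact ⟨n, hn, Or.inr h⟩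

theorem wythoffLower_ne {m n : ℕ} (hm : 1 ≤ m) : wythoffLower m ≠ wythoffLower n + n := by
  intro h
  have hpos : 0 < wythoffLower m := by
    have := wythoffLower_strictMono.le_apply (x := m)
    omega
  have hn : 1 ≤ n := by
    by_contra hn
    obtain rfl : n = 0 := by omega
    rw [wythoffLower_zero] at h
    omega
  rcases (pos_iff_xor_wythoff _).1 hpos with ⟨-, h'⟩ | ⟨-, h'⟩
  · exact h' ⟨n, hn, h⟩
  · exact h' ⟨m, hm, rfl⟩

/-- Consecutive terms of the upper Wythoff sequence differ by at least `2`, so the successor of a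
term belongs to the lower sequence. -/
theorem exists_wythoffLower_eq_add_one (m : ℕ) :
    ∃ n, 1 ≤ n ∧ wythoffLower n = wythoffLower m + m + 1 := by
  obtain ⟨n, hn, h | h⟩ := exists_wythoff_eq (Nat.succ_pos (wythoffLower m + m))
  · exact ⟨n, hn, h.symm⟩
  · rcases lt_or_ge m n with hmn | hmn
    · have := wythoffLower_strictMono hmn
      omega
    · have := wythoffLower_strictMono.monotone hmn
      omega

/-! ### The sequence `g` -/

theorem gSeq_of_wythoff_eq {n m : ℕ} (hn : 2 ≤ n)
    (h : wythoffLower n = wythoffLower m + m + 1) : gSeq n = 1 - gSeq m := by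
  apply gSeq_of_floor_eq hn
  rw [floor_mul_goldenRatio, floor_mul_goldenRatio_add_one]
  omega

/-- The zeros of `g` from `2` on are the `n` with `⌊nφ⌋ = ⌊mφ²⌋ + 1` for some `m` with `g m = 1`.
Such an `m` is at least `2`, because `m = 0` and `m = 1` belong to `n = 1` and `n = 2`, and
`g 2 = 1 - g 1 = 1`. -/
theorem exists_of_gSeq_eq_zero {n : ℕ} (hn : 2 ≤ n) (h : gSeq n = 0) :
    ∃ m, 2 ≤ m ∧ gSeq m = 1 ∧ wythoffLower n = wythoffLower m + m + 1 := by
  have hex : ∃ m, wythoffLower n = wythoffLower m + m + 1 := by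
    by_contra! hne
    have := gSeq_of_forall_floor_ne hn fun m hm => hne m (by
      rw [floor_mul_goldenRatio, floor_mul_goldenRatio_add_one] at hm
      omega)
    omega
  obtain ⟨m, hm⟩ := hex
  have hg := gSeq_of_wythoff_eq hn hm
  have hle := gSeq_le_one m
  refine ⟨m, ?_, by omega, hm⟩
  by_contra hlt
  obtain rfl | rfl : m = 0 ∨ m = 1 := by omega
  · rw [wythoffLower_zero] at hm
    have := wythoffLower_strictMono hn
    rw [wythoffLower_one] at this
    omega
  · rw [gSeq_one] at hg
    omega

/-! ### The perturbed Wythoff pairs -/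

/-- The smaller entry `⌊nφ⌋ + g n - 1` of the `n`-th pair. The subtraction does not truncate, since
`g 0 = 1` and `⌊nφ⌋ ≥ 1` for `n ≥ 1`. -/
noncomputable def lowerSeq (n : ℕ) : ℕ := wythoffLower n + gSeq n - 1

/-- The larger entry `⌊nφ²⌋ + g n` of the `n`-th pair. -/
noncomputable def upperSeq (n : ℕ) : ℕ := wythoffLower n + n + gSeq n

theorem lowerSeq_add_one (n : ℕ) : lowerSeq n + 1 = wythoffLower n + gSeq n := by
  have h : 1 ≤ wythoffLower n + gSeq n := by
    rcases n.eq_zero_or_pos with rfl | hn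
    · rw [gSeq_zero]
      omega
    · have := wythoffLower_strictMono.le_apply (x := n)
      omega
  rw [lowerSeq]
  omega

theorem lowerSeq_lt_of_lt {m n : ℕ} (hmn : m < n) (hn : 2 ≤ n) : lowerSeq m < lowerSeq n := by
  have hm1 := lowerSeq_add_one m
  have hn1 := lowerSeq_add_one n
  have hA := wythoffLower_strictMono hmn
  have hgm := gSeq_le_one m
  rcases Nat.eq_zero_or_pos (gSeq n) with hg | hg
  · -- Here `⌊nφ⌋ - 1` is an upper Wythoff number, so the lower sequence skips it.
    obtain ⟨k, -, -, hk⟩ := exists_of_gSeq_eq_zero hn hg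
    rcases m.eq_zero_or_pos with rfl | hm
    · have := wythoffLower_strictMono.le_apply (x := n)
      rw [wythoffLower_zero] at hm1
      omega
    · have := wythoffLower_ne (n := k) hm
      omega
  · omega

theorem lowerSeq_ne_upperSeq {m n : ℕ} (hm : 2 ≤ m) (hn : 2 ≤ n) :
    lowerSeq m ≠ upperSeq n := by
  intro h
  have hm1 := lowerSeq_add_one m
  have hgn := gSeq_le_one n
  have hgm := gSeq_le_one m
  rw [upperSeq] at h
  rcases Nat.eq_zero_or_pos (gSeq m) with hg | hg
  · obtain ⟨k, hk, hgk, hmk⟩ := exists_of_gSeq_eq_zero hm hg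
    rcases Nat.eq_zero_or_pos (gSeq n) with hg' | hg'
    · -- `⌊kφ²⌋ = ⌊nφ²⌋` forces `k = n`, but `g k = 1` and `g n = 0`.
      rcases lt_trichotomy k n with hkn | rfl | hkn
      · have := wythoffLower_strictMono hkn
        omega
      · omega
      · have := wythoffLower_strictMono hkn
        omega
    · obtain ⟨l, hl, hln⟩ := exists_wythoffLower_eq_add_one n
      exact wythoffLower_ne (n := k) hl (by omega)
  · rcases Nat.eq_zero_or_pos (gSeq n) with hg' | hg'
    · exact wythoffLower_ne (m := m) (n := n) (by omega) (by omega)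
    · have := gSeq_of_wythoff_eq (n := m) (m := n) hm (by omega)
      omega

theorem exists_eq_lowerSeq_or_upperSeq {v : ℕ} (hv : 3 ≤ v) :
    ∃ n, 2 ≤ n ∧ (v = lowerSeq n ∨ v = upperSeq n) := by
  obtain ⟨n, hn, h⟩ := exists_wythoff_eq (show 0 < v by omega)
  have hn2 : 2 ≤ n := by
    by_contra hlt
    obtain rfl : n = 1 := by omega
    rw [wythoffLower_one] at h
    omega
  have hgn := gSeq_le_one n
  have hn1 := lowerSeq_add_one n
  rcases Nat.eq_zero_or_pos (gSeq n) with hg | hg <;> rcases h with h | h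
  · obtain ⟨m, hm, hgm, hnm⟩ := exists_of_gSeq_eq_zero hn2 hg
    exact ⟨m, hm, Or.inr (by rw [upperSeq]; omega)⟩
  · exact ⟨n, hn2, Or.inr (by rw [upperSeq]; omega)⟩
  · exact ⟨n, hn2, Or.inl (by omega)⟩
  · obtain ⟨k, hk, hkn⟩ := exists_wythoffLower_eq_add_one n
    have hk2 : 2 ≤ k := by
      by_contra hlt
      obtain rfl : k = 1 := by omega
      rw [wythoffLower_one] at hkn
      omega
    have hgk := gSeq_of_wythoff_eq hk2 hkn
    have hk1 := lowerSeq_add_one k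
    exact ⟨k, hk2, Or.inl (by omega)⟩

theorem isK2PairSystem_lowerSeq_upperSeq : IsK2PairSystem lowerSeq upperSeq where
  b_eq n := by
    have := lowerSeq_add_one n
    rw [upperSeq]
    omega
  a_zero := by rw [lowerSeq, wythoffLower_zero, gSeq_zero]
  a_one := by rw [lowerSeq, wythoffLower_one, gSeq_one]
  three_le n hn := by
    have h2 : lowerSeq 2 = 3 := by
      have hg := gSeq_of_wythoff_eq (n := 2) (m := 1) le_rfl
        (by rw [wythoffLower_two, wythoffLower_one])
      rw [lowerSeq, wythoffLower_two, hg, gSeq_one]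
    rcases hn.eq_or_lt with rfl | hlt
    · exact h2.ge
    · have := lowerSeq_lt_of_lt hlt hn
      omega
  mono _ _ := lowerSeq_lt_of_lt
  disjoint _ _ := lowerSeq_ne_upperSeq
  cover _ := exists_eq_lowerSeq_or_upperSeq

theorem floor_add_gSeq_sub_one (n : ℕ) :
    ⌊(n : ℝ) * Real.goldenRatio⌋ + (gSeq n : ℤ) - 1 = (lowerSeq n : ℤ) := by
  have := lowerSeq_add_one n
  rw [floor_mul_goldenRatio]
  omega

theorem floor_sq_add_gSeq (n : ℕ) :
    ⌊(n : ℝ) * Real.goldenRatio ^ 2⌋ + (gSeq n : ℤ) = (upperSeq n : ℤ) := by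
  rw [Real.goldenRatio_sq, floor_mul_goldenRatio_add_one, upperSeq]
  omega

theorem mainTheorem5 :
    (fun p : ℕ × ℕ => ((p.1 : ℤ), (p.2 : ℤ))) '' {p : ℕ × ℕ | IsK2PPosition p} =
      {((0 : ℤ), (0 : ℤ)), ((1 : ℤ), (1 : ℤ))} ∪
      ({p : ℤ × ℤ | ∃ n : ℕ,
          p = (⌊(n : ℝ) * Real.goldenRatio⌋ + (gSeq n : ℤ) - 1,
               ⌊(n : ℝ) * Real.goldenRatio ^ 2⌋ + (gSeq n : ℤ))} ∪
       {p : ℤ × ℤ | ∃ n : ℕ,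
          p = (⌊(n : ℝ) * Real.goldenRatio ^ 2⌋ + (gSeq n : ℤ),
               ⌊(n : ℝ) * Real.goldenRatio⌋ + (gSeq n : ℤ) - 1)}) := by
  simp only [floor_add_gSeq_sub_one, floor_sq_add_gSeq,
    isK2PairSystem_lowerSeq_upperSeq.isK2PPosition_iff]
  ext p
  constructor
  · rintro ⟨q, rfl | rfl | ⟨n, rfl⟩ | ⟨n, rfl⟩, rfl⟩
    · exact Or.inl (Or.inl rfl)
    · exact Or.inl (Or.inr rfl)
    · exact Or.inr (Or.inl ⟨n, rfl⟩)
    · exact Or.inr (Or.inr ⟨n, rfl⟩)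
  · rintro ((rfl | rfl) | (⟨n, rfl⟩ | ⟨n, rfl⟩))
    · exact ⟨(0, 0), Or.inl rfl, rfl⟩
    · exact ⟨(1, 1), Or.inr (Or.inl rfl), rfl⟩
    · exact ⟨(lowerSeq n, upperSeq n), Or.inr (Or.inr (Or.inl ⟨n, rfl⟩)), rfl⟩
    · exact ⟨(upperSeq n, lowerSeq n), Or.inr (Or.inr (Or.inr ⟨n, rfl⟩)), rfl⟩
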